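/- Let $n\ge 1$ and let $S_n$ be the group of permutations of $[n]=\{1,\dots,n\}$. Fix an algebraic closure $\overline{\mathbb Q}$ of $\mathbb Q$. For a number field $K\subset\overline{\mathbb Q}$ of degree $n$, let $\Delta_K$ be its discriminant and $\widetilde K$ its Galois closure over $\mathbb Q$; the group $\mathrm{Gal}(\widetilde K/\mathbb Q)$ acts on the $n$ embeddings $\tau:K\to\widetilde K$ by $\sigma\cdot\tau=\sigma\circ\tau$. For a transitive subgroup $G\subseteq S_n$ and a real number $X>0$, let $N_n(X;G)$ be the number of number fields $K\subset\overline{\mathbb Q}$ with $[K:\mathbb Q]=n$ and $|\Delta_K|\le X$ for which $\mathrm{Gal}(\widetilde K/\mathbb Q)$, with this action, is isomorphic to $G$ as a permutation group (that is, there are a group isomorphism $\varphi:\mathrm{Gal}(\widetilde K/\mathbb Q)\to G$ and a bijection $b$ from the embeddings of $K$ to $[n]$ with $b(\sigma\circ\tau)=\varphi(\sigma)(b(\tau))$ for all $\sigma,\tau$). Let $G\subseteq S_n$ be transitive, let $H=G\cap S_{n-1}$ be the stabilizer in $G$ of the letter $1$, let $N$ be the normalizer of $H$ in $G$, and put $r=|N/H|$.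 Let $g_1,\dots,g_r\in N$ represent the elements of $N/H$, each exactly once. Identify $[n]$ with $G/H$, the letter $i$ corresponding to the coset $\{g\in G: g(1)=i\}$. For $1\le j\le r$ let $\pi_j\in S_n$ be the permutation induced by $gH\mapsto g g_jH$; thus $\pi_j(i)=(g g_j)(1)$ for any $g\in G$ with $g(1)=i$. For $\mathbf a=(a_1,\dots,a_r)\in\mathbb Z_{\ge0}^r$ set $$\mathrm{Tr}_{\mathbf a}(x_1,\dots,x_n)=\sum_{i=1}^n\prod_{j=1}^r x_{\pi_j(i)}^{a_j}\in\mathbb Z[x_1,\dots,x_n],\qquad H(\mathbf a)=\sum_{j=1}^r a_j .$$ Proposition. Let $\mathbf a_1,\dots,\mathbf a_n\in\mathbb Z_{\ge 0}^r$ and put $f_i=\mathrm{Tr}_{\mathbf a_i}$. If the determinant of the Jacobian matrix $\left(\partial f_i/\partial x_j\right)_{1\le i,j\le n}$ is not identically $0$, then $N_n(X;G)$ is finite and $$N_n(X;G)\le C\,X^{\frac1n\sum_{i=1}^n H(\mathbf a_i)}\qquad\text{for all } X>0,$$ where the constant $C$ depends only on the vectors $\mathbf a_1,\dots,\mathbf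 a_n$ (and hence on $n$ and $r$). -/

import Mathlib

namespace NumberFieldCount

section Permutations

/-- For `ν` in the normalizer of `H`, right multiplication by `ν` is a well-defined permutation
`γ H ↦ γ ν H` of the set of left cosets of `H`. -/
def cosetPerm {Γ : Type*} [Group Γ] (H : Subgroup Γ)
    (ν : (Subgroup.normalizer (H : Set Γ) : Subgroup Γ)) : Equiv.Perm (Γ ⧸ H) where
  toFun := Quotient.map' (fun γ => γ * (ν : Γ)) (by
    intro x y h
    rw [QuotientGroup.leftRel_apply] at h ⊢
    have h2 := (Subgroup.mem_normalizer_iff.mp (ν⁻¹).2 _).mp h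
    simpa [mul_assoc] using h2)
  invFun := Quotient.map' (fun γ => γ * (ν : Γ)⁻¹) (by
    intro x y h
    rw [QuotientGroup.leftRel_apply] at h ⊢
    have h2 := (Subgroup.mem_normalizer_iff.mp ν.2 _).mp h
    simpa [mul_assoc] using h2)
  left_inv := by
    rintro ⟨γ⟩
    exact congrArg (QuotientGroup.mk (s := H)) (mul_inv_cancel_right γ (ν : Γ))
  right_inv := by
    rintro ⟨γ⟩
    exact congrArg (QuotientGroup.mk (s := H)) (inv_mul_cancel_right γ (ν : Γ))

variable {n : ℕ} [NeZero n] (G : Subgroup (Equiv.Perm (Fin n)))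

/-- `H = G ∩ S_{n-1}`: the subgroup of `G` fixing the first of the `n` letters. -/
abbrev pointStabilizer : Subgroup G := MulAction.stabilizer G (0 : Fin n)

/-- The normalizer `N` of `H` in `G`. -/
abbrev stabilizerNormalizer : Subgroup G :=
  Subgroup.normalizer (pointStabilizer G : Set G)

/-- The quotient group `N / H`. -/
abbrev normalizerQuotient : Type :=
  stabilizerNormalizer G ⧸ (pointStabilizer G).subgroupOf (stabilizerNormalizer G)

/-- The identification of `G / H` with the set of letters: the coset `g H` corresponds to the
image of the first letter under `g`. -/
noncomputable def cosetEquiv [MulAction.IsPretransitive G (Fin n)] :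
    (G ⧸ pointStabilizer G) ≃ Fin n :=
  Equiv.ofBijective (MulAction.ofQuotientStabilizer G (0 : Fin n))
    ⟨MulAction.injective_ofQuotientStabilizer G 0, fun i => by
      obtain ⟨g, hg⟩ := MulAction.exists_smul_eq G (0 : Fin n) i
      exact ⟨QuotientGroup.mk g, by simpa using hg⟩⟩

/-- The permutation of the letters attached to `ν ∈ N`: if `i` corresponds to the coset `g H`,
then `i` is sent to the letter corresponding to `g H ν H = g ν H`. -/
noncomputable def assocPerm [MulAction.IsPretransitive G (Fin n)]
    (ν : stabilizerNormalizer G) : Equiv.Perm (Fin n) :=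
  (cosetEquiv G).permCongr (cosetPerm (pointStabilizer G) ν)

theorem assocPerm_apply [MulAction.IsPretransitive G (Fin n)]
    (ν : stabilizerNormalizer G) (g : G) :
    assocPerm G ν (g • (0 : Fin n)) = (g * (ν : G)) • (0 : Fin n) := by
  have h : (cosetEquiv G).symm (g • (0 : Fin n)) = QuotientGroup.mk g := by
    rw [Equiv.symm_apply_eq]
    rfl
  rw [assocPerm, Equiv.permCongr_apply, h]
  rfl

/-- The trace function `Tr_a = ∑ i, ∏ j, x_{π_j(i)} ^ a_j`, where `π_j` is the permutation
attached to the representative `g j` of the `j`-th element of `N / H`. -/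
noncomputable def traceFunction [MulAction.IsPretransitive G (Fin n)] {r : ℕ}
    (g : Fin r → stabilizerNormalizer G) (a : Fin r → ℕ) : MvPolynomial (Fin n) ℤ :=
  ∑ i : Fin n, ∏ j : Fin r, MvPolynomial.X (assocPerm G (g j) i) ^ a j

end Permutations

/-- The Jacobian matrix `(∂ f_i / ∂ x_j)` of `n` polynomials in `n` variables. -/
noncomputable def jacobianMatrix {n : ℕ} (f : Fin n → MvPolynomial (Fin n) ℤ) :
    Matrix (Fin n) (Fin n) (MvPolynomial (Fin n) ℤ) :=
  Matrix.of fun i j => MvPolynomial.pderiv j (f i)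

/-- `H(a)`, the sum of the entries of `a`. -/
def height {r : ℕ} (a : Fin r → ℕ) : ℕ := ∑ j : Fin r, a j

/-- The Galois closure of `K` over `ℚ`, inside the fixed algebraic closure of `ℚ`. -/
noncomputable abbrev galoisClosure (K : IntermediateField ℚ (AlgebraicClosure ℚ)) :
    IntermediateField ℚ (AlgebraicClosure ℚ) :=
  IntermediateField.normalClosure ℚ K (AlgebraicClosure ℚ)

/-- The Galois group of the Galois closure of `K`, acting on the embeddings `τ` of `K` by
`σ · τ = σ ∘ τ`, is isomorphic to `G` as a permutation group: there are a group isomorphism onto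
`G` and a compatible labelling of the embeddings by the letters. -/
def HasGaloisGroup {n : ℕ} (K : IntermediateField ℚ (AlgebraicClosure ℚ))
    (G : Subgroup (Equiv.Perm (Fin n))) : Prop :=
  ∃ (φ : (galoisClosure K ≃ₐ[ℚ] galoisClosure K) ≃* G)
    (b : (K →ₐ[ℚ] galoisClosure K) ≃ Fin n),
    ∀ (σ : galoisClosure K ≃ₐ[ℚ] galoisClosure K) (τ : K →ₐ[ℚ] galoisClosure K),
      b ((σ : galoisClosure K →ₐ[ℚ] galoisClosure K).comp τ) = φ σ • b τ

/-- The number fields `K` (inside the fixed algebraic closure of `ℚ`) with `[K : ℚ] = n`,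
`|Δ_K| ≤ X` and Galois group `G` as a permutation group. -/
def fieldsWithGroup {n : ℕ} (G : Subgroup (Equiv.Perm (Fin n))) (X : ℝ) :
    Set (IntermediateField ℚ (AlgebraicClosure ℚ)) :=
  {K | ∃ _ : NumberField K, Module.finrank ℚ K = n ∧ |(NumberField.discr K : ℝ)| ≤ X ∧
    HasGaloisGroup K G}

/-- `N_n(X; G)`, the number of such fields. -/
noncomputable def countFields {n : ℕ} (G : Subgroup (Equiv.Perm (Fin n))) (X : ℝ) : ℕ :=
  (fieldsWithGroup G X).ncard

end NumberFieldCount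

/-!
A number field `K` of degree `n` with group `G` is recorded by the values of the trace functions at
the conjugates of a well-chosen generator; these values are rational integers of bounded size, and
few fields share the same values.

*A small generator.* A nonzero element of the dual of the ring of integers under the trace form has
norm at least `1 / |Δ|`, hence length at least about `|Δ| ^ (-1 / n)`
(`one_le_abs_norm_mul_abs_discr`). By the transference principle `exists_short_dual_family`, a
lattice without short vectors has a dual lattice with a basis of small vectors, so the ring of
integers contains `n` independent elements with all conjugates `O(|Δ| ^ (1 / n))`
(`exists_linearIndependent_integers_norm_le`). Some combination `α` of them with bounded natural
number coefficients avoids the zeros of the Jacobian determinant and of the Vandermonde determinant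
at its vector of conjugates (`exists_integer_eval_conjugates_ne_zero`); the second condition says
that `α` generates `K`.

*Its invariants.* The permutations `π_j` commute with `G`, so a trace function `Tr_a` at the
conjugates of `α` is fixed by the Galois group and is a rational integer
(`exists_int_aeval_traceFunction_conjugates`), of size `O(X ^ (H(a) / n))`. The integral vectors of
this size number `O(X ^ (∑ H(a_i) / n))`.

*The fibres.* The polynomial map given by the trace functions is a local isomorphism at points where
the Jacobian determinant does not vanish. The number of such points in a fibre is bounded
independently of the fibre (`exists_card_nondegenerate_fiber_le`), by deforming to a generic fibre.
The field is determined by the point together with the letter of the conjugate `α`.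
-/

/-! ### Lattices without short vectors -/

section Transference

open scoped InnerProductSpace

/-- The transference principle. If all nonzero vectors of a lattice of rank `n` have length at least
`m`, then the lattice has a basis `b` with a dual family `e` of vectors of length at most `C / m`,
with `C` depending only on `n`.

The lattice is given as a free `ℤ`-module `M` with an additive map `f` to a Euclidean space. The
induction takes an almost shortest vector `y` (whether the minimum is attained does not matter),
applies the hypothesis to `M ⧸ ℤ y` mapped to the orthogonal complement of `f y`, where the minimum
drops by a factor of at most `4`, and lifts the basis found there so that the components along `f y`
are at most half of `f y`. -/
theorem exists_short_dual_family (n : ℕ) : ∃ C : ℝ, 0 ≤ C ∧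
    ∀ (E : Type*) [NormedAddCommGroup E] [InnerProductSpace ℝ E]
      (M : Type*) [AddCommGroup M] [Module.Free ℤ M] [Module.Finite ℤ M],
      Module.finrank ℤ M = n → ∀ (f : M →+ E) (m : ℝ), 0 < m → (∀ x, x ≠ 0 → m ≤ ‖f x‖) →
      ∃ (b : Fin n → M) (e : Fin n → E), Submodule.span ℤ (Set.range b) = ⊤ ∧
        (∀ i j, ⟪e i, f (b j)⟫_ℝ = if i = j then 1 else 0) ∧ ∀ i, ‖e i‖ ≤ C / m := by
  induction n with
  | zero =>
    refine ⟨0, le_rfl, fun E _ _ M _ _ _ hM f m hm hf => ⟨0, 0, ?_, by simp, by simp⟩⟩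
    have := Module.finrank_zero_iff.mp hM
    exact Subsingleton.elim _ _
  | succ n ih =>
    obtain ⟨C, hC0, hC⟩ := ih
    refine ⟨1 + 2 * n * C + 4 * C, by positivity, fun E _ _ M _ _ _ hM f m hm hf => ?_⟩
    have hnt : Nontrivial M := Module.nontrivial_of_finrank_pos (R := ℤ) (by omega)
    -- the infimum `μ` of the lengths, and a vector `y` with `‖f y‖ < 3 / 2 * μ`: rounding to the
    -- nearest multiple of `f y` then costs less than `3 / 4 * μ`
    set S : Set ℝ := (fun x => ‖f x‖) '' {x | x ≠ 0} with hS
    have hSne : S.Nonempty := by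
      obtain ⟨x, hx⟩ := exists_ne (0 : M)
      exact ⟨_, x, hx, rfl⟩
    have hSbdd : BddBelow S := ⟨m, by rintro _ ⟨x, hx, rfl⟩; exact hf x hx⟩
    set μ := sInf S with hμ
    have hmμ : m ≤ μ := le_csInf hSne (by rintro _ ⟨x, hx, rfl⟩; exact hf x hx)
    have hμf : ∀ x, x ≠ 0 → μ ≤ ‖f x‖ := fun x hx => csInf_le hSbdd ⟨x, hx, rfl⟩
    obtain ⟨_, ⟨y, hy, rfl⟩, hyμ⟩ := exists_lt_of_csInf_lt hSne
      (show sInf S < 3 / 2 * μ by rw [← hμ]; linarith)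
    have hy : y ≠ 0 := hy
    have hyμ : ‖f y‖ < 3 / 2 * μ := hyμ
    have hfy : 0 < ‖f y‖ := hm.trans_le (hf y hy)
    -- lattice points close to the line through `f y` are multiples of `y`
    have key : ∀ (x : M) (t : ℝ), ‖f x - t • f y‖ < μ / 4 → x ∈ Submodule.span ℤ {y} := by
      intro x t h
      have h1 : x - round t • y = 0 := by
        by_contra hne
        have h2 := hμf _ hne
        have h3 : f (x - round t • y) = (f x - t • f y) + (t - round t) • f y := by
          rw [map_sub, map_zsmul, sub_smul, ← Int.cast_smul_eq_zsmul ℝ]; abel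
        have h4 : ‖(t - round t) • f y‖ ≤ 1 / 2 * ‖f y‖ := by
          rw [norm_smul, Real.norm_eq_abs]
          exact mul_le_mul_of_nonneg_right (abs_sub_round t) hfy.le
        rw [h3] at h2
        have := norm_add_le (f x - t • f y) ((t - round t) • f y)
        linarith
      rw [Submodule.mem_span_singleton]
      exact ⟨round t, (sub_eq_zero.mp h1).symm⟩
    -- in particular the line through `f y` meets the lattice in `ℤ y`, so `M ⧸ ℤ y` is free
    set Q := M ⧸ Submodule.span ℤ {y}
    have htf : Module.IsTorsionFree ℤ Q := by
      rw [Module.isTorsionFree_iff_smul_eq_zero]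
      intro k z hkz
      obtain ⟨x, rfl⟩ := Submodule.Quotient.mk_surjective _ z
      refine or_iff_not_imp_left.mpr fun hk => ?_
      rw [← Submodule.Quotient.mk_smul, Submodule.Quotient.mk_eq_zero,
        Submodule.mem_span_singleton] at hkz
      obtain ⟨l, hl⟩ := hkz
      have hk' : (k : ℝ) ≠ 0 := Int.cast_ne_zero.mpr hk
      have h1 : (l : ℝ) • f y = (k : ℝ) • f x := by
        rw [Int.cast_smul_eq_zsmul, Int.cast_smul_eq_zsmul, ← map_zsmul, ← map_zsmul, hl]
      have h2 : f x - ((l : ℝ) / k) • f y = 0 := by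
        rw [div_eq_inv_mul, mul_smul, h1, smul_smul, inv_mul_cancel₀ hk', one_smul, sub_self]
      refine (Submodule.Quotient.mk_eq_zero _).mpr (key x (l / k) ?_)
      rw [h2, norm_zero]
      linarith
    have hQ : Module.finrank ℤ Q = n := by
      have h1 : Module.finrank ℤ Q + _ = _ :=
        Submodule.finrank_quotient_add_finrank (Submodule.span ℤ {y})
      have h2 : Module.finrank ℤ (Submodule.span ℤ {y}) = 1 := by
        rw [← (LinearEquiv.toSpanNonzeroSingleton ℤ M y hy).finrank_eq, Module.finrank_self]
      omega
    -- the induced map on the quotient, with values in the orthogonal complement of `f y`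
    set P : E →L[ℝ] E := (ℝ ∙ f y)ᗮ.starProjection with hP
    have hPy : P (f y) = 0 := Submodule.starProjection_orthogonalComplement_singleton_eq_zero _
    have hPx : ∀ x, ∃ t : ℝ, P x = x - t • f y := by
      intro x
      have h1 := Submodule.starProjection_add_starProjection_orthogonal (K := ℝ ∙ f y) x
      rw [Submodule.starProjection_singleton] at h1
      exact ⟨_, eq_sub_of_add_eq' h1⟩
    set f' : Q →ₗ[ℤ] E := Submodule.liftQ (Submodule.span ℤ {y})
      ((P : E →+ E).comp f).toIntLinearMap (by
        rw [Submodule.span_singleton_le_iff_mem]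
        exact hPy) with hf'
    have hf'mk : ∀ x : M, f' (Submodule.Quotient.mk x) = P (f x) := fun x => rfl
    have hf'm : ∀ z : Q, z ≠ 0 → m / 4 ≤ ‖f' z‖ := by
      intro z
      obtain ⟨x, rfl⟩ := Submodule.Quotient.mk_surjective _ z
      intro hz
      rw [hf'mk]
      by_contra! hlt
      obtain ⟨t, ht⟩ := hPx (f x)
      refine hz ((Submodule.Quotient.mk_eq_zero _).mpr (key x t ?_))
      rw [← ht]
      linarith
    obtain ⟨b', e', hspan, hpair, hnorm⟩ := hC E Q hQ f'.toAddMonoidHom (m / 4) (by linarith) hf'm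
    -- lifts of the `b'` whose component along `f y` is at most half of `f y`
    set w : E := (‖f y‖ ^ 2)⁻¹ • f y with hw
    have hwy : ⟪w, f y⟫_ℝ = 1 := by
      rw [hw, real_inner_smul_left, real_inner_self_eq_norm_sq]
      field_simp
    have hlift : ∀ i, ∃ s : M, (Submodule.Quotient.mk s : Q) = b' i ∧ |⟪w, f s⟫_ℝ| ≤ 1 / 2 := by
      intro i
      obtain ⟨s, hs⟩ := Submodule.Quotient.mk_surjective _ (b' i)
      refine ⟨s - round ⟪w, f s⟫_ℝ • y, ?_, ?_⟩
      · rw [← hs, Submodule.Quotient.eq]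
        simp [Submodule.mem_span_singleton]
      · rw [map_sub, map_zsmul, ← Int.cast_smul_eq_zsmul ℝ, inner_sub_right, real_inner_smul_right,
          hwy, mul_one]
        exact abs_sub_round _
    choose s hs hsw using hlift
    have hPe : ∀ i x, ⟪P (e' i), f x⟫_ℝ = ⟪e' i, f' (Submodule.Quotient.mk x)⟫_ℝ := by
      intro i x
      rw [hf'mk, hP, Submodule.inner_starProjection_left_eq_right]
    have hPey : ∀ i, ⟪P (e' i), f y⟫_ℝ = 0 := by
      intro i
      rw [hP, Submodule.inner_starProjection_left_eq_right, ← hP, hPy, inner_zero_right]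
    have hPes : ∀ i j, ⟪P (e' i), f (s j)⟫_ℝ = if i = j then 1 else 0 := by
      intro i j
      rw [hPe, hs]
      exact hpair i j
    have hPn : ∀ i, ‖P (e' i)‖ ≤ 4 * C / m := by
      intro i
      refine (Submodule.norm_starProjection_apply_le _ _).trans ((hnorm i).trans (le_of_eq ?_))
      field_simp
    -- the vector dual to `y` is `w`, corrected to be orthogonal to the lifts
    refine ⟨Fin.cons y s,
      Fin.cons (w - ∑ i, ⟪w, f (s i)⟫_ℝ • P (e' i)) (fun i => P (e' i)), ?_, ?_, ?_⟩
    · rw [eq_top_iff]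
      intro x _
      have h1 : (Submodule.Quotient.mk x : Q) ∈ Submodule.span ℤ (Set.range b') := hspan ▸ trivial
      obtain ⟨c, hc⟩ := (Submodule.mem_span_range_iff_exists_fun ℤ).mp h1
      have h2 : x - ∑ i, c i • s i ∈ Submodule.span ℤ {y} := by
        rw [← Submodule.Quotient.mk_eq_zero, Submodule.Quotient.mk_sub, ← hc, ← Submodule.mkQ_apply,
          map_sum]
        simp [hs]
      obtain ⟨l, hl⟩ := Submodule.mem_span_singleton.mp h2
      refine (Submodule.mem_span_range_iff_exists_fun ℤ).mpr ⟨Fin.cons l c, ?_⟩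
      rw [Fin.sum_univ_succ]
      simp [hl]
    · intro i j
      refine Fin.cases ?_ (fun i => ?_) i <;> refine Fin.cases ?_ (fun j => ?_) j
      · simp [inner_sub_left, sum_inner, real_inner_smul_left, hwy, hPey]
      · simp [inner_sub_left, sum_inner, real_inner_smul_left, hPes, (Fin.succ_ne_zero j).symm]
      · simp [hPey]
      · simp [hPes]
    · intro i
      refine Fin.cases ?_ (fun i => ?_) i
      · rw [Fin.cons_zero]
        have h1 : ‖w‖ ≤ 1 / m := by
          rw [hw, norm_smul, norm_inv, norm_pow, norm_norm]
          rw [show (‖f y‖ ^ 2)⁻¹ * ‖f y‖ = 1 / ‖f y‖ by field_simp]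
          exact one_div_le_one_div_of_le hm (hf y hy)
        have h2 : ‖∑ i, ⟪w, f (s i)⟫_ℝ • P (e' i)‖ ≤ ∑ _i : Fin n, 1 / 2 * (4 * C / m) := by
          refine norm_sum_le_of_le _ fun i _ => ?_
          rw [norm_smul, Real.norm_eq_abs]
          exact mul_le_mul (hsw i) (hPn i) (norm_nonneg _) (by norm_num)
        rw [Finset.sum_const, Finset.card_univ, Fintype.card_fin, nsmul_eq_mul] at h2
        have h3 : 0 ≤ 4 * C / m := by positivity
        calc _ ≤ _ := norm_sub_le _ _
          _ ≤ 1 / m + n * (1 / 2 * (4 * C / m)) := add_le_add h1 h2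
          _ ≤ 1 / m + n * (1 / 2 * (4 * C / m)) + 4 * C / m := by linarith
          _ = _ := by field_simp; ring
      · rw [Fin.cons_succ]
        refine (hPn i).trans ?_
        gcongr
        have : 0 ≤ 2 * n * C := by positivity
        linarith

end Transference

/-! ### Small elements of the ring of integers -/

section SmallIntegers

open scoped InnerProductSpace
open NumberField

/-- A nonzero element `y` of the dual of the ring of integers under the trace form has norm at least
`1 / |Δ|`: for an integral basis `ω`, the matrix of the rational integers `Tr(y ω i ω j)` has
determinant `N(y) Δ`. -/
theorem one_le_abs_norm_mul_abs_discr {K : Type*} [Field K] [NumberField K] {y : K} (hy : y ≠ 0)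
    (htr : ∀ x : 𝓞 K, ∃ k : ℤ, Algebra.trace ℚ K (y * x) = k) :
    1 ≤ |Algebra.norm ℚ y| * |(discr K : ℚ)| := by
  classical
  set ω := integralBasis K with hω
  have hA : ((Algebra.leftMulMatrix ω y).transpose * Algebra.traceMatrix ℚ ω) =
      Matrix.of fun i j => Algebra.trace ℚ K (y * (ω i * ω j)) := by
    ext i j
    rw [Matrix.mul_apply, Matrix.of_apply, ← mul_assoc]
    have h1 : y * ω i = ∑ k, (Algebra.leftMulMatrix ω y) k i • ω k := by
      conv_lhs => rw [← ω.sum_repr (y * ω i)]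
      simp [Algebra.leftMulMatrix_eq_repr_mul]
    rw [h1, Finset.sum_mul, map_sum]
    refine Finset.sum_congr rfl fun k _ => ?_
    rw [Matrix.transpose_apply, Algebra.traceMatrix_apply, Algebra.traceForm_apply,
      smul_mul_assoc, map_smul, smul_eq_mul]
  have hint : ∀ i j, ∃ k : ℤ, Algebra.trace ℚ K (y * (ω i * ω j)) = k := by
    intro i j
    have := htr (RingOfIntegers.basis K i * RingOfIntegers.basis K j)
    simpa [hω, integralBasis_apply] using this
  choose B hB using hint
  have hdet : Algebra.norm ℚ y * (discr K : ℚ) = ((Matrix.of B).det : ℤ) := by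
    rw [Algebra.norm_eq_matrix_det ω, coe_discr, Algebra.discr_def, ← hω, ← Matrix.det_transpose,
      ← Matrix.det_mul, hA, Int.cast_det]
    congr 1
    ext i j
    simp [hB]
  have hne : Algebra.norm ℚ y * (discr K : ℚ) ≠ 0 :=
    mul_ne_zero (Algebra.norm_ne_zero_iff.mpr hy) (Int.cast_ne_zero.mpr (discr_ne_zero K))
  rw [← abs_mul, hdet, ← Int.cast_abs]
  rw [hdet] at hne
  exact_mod_cast Int.one_le_abs (Int.cast_ne_zero.mp hne)

/-- A nonzero element of the dual of the ring of integers has a conjugate of absolute value at least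
`|Δ| ^ (-1 / n)`. -/
theorem inv_rpow_discr_le_of_forall_trace {K : Type*} [Field K] [NumberField K] {y : K} (hy : y ≠ 0)
    (htr : ∀ x : 𝓞 K, ∃ k : ℤ, Algebra.trace ℚ K (y * x) = k) {t : ℝ}
    (ht : ∀ σ : K →ₐ[ℚ] ℂ, ‖σ y‖ ≤ t) :
    (|(discr K : ℝ)| ^ (1 / (Module.finrank ℚ K : ℝ)))⁻¹ ≤ t := by
  have hn : Module.finrank ℚ K ≠ 0 := Module.finrank_pos.ne'
  have h1 : (1 : ℝ) ≤ |(Algebra.norm ℚ y : ℝ)| * |(discr K : ℝ)| := by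
    exact_mod_cast one_le_abs_norm_mul_abs_discr hy htr
  have ht0 : 0 ≤ t := by
    obtain ⟨σ⟩ : Nonempty (K →ₐ[ℚ] ℂ) := by
      rw [← Fintype.card_pos_iff, AlgHom.card]
      exact Module.finrank_pos
    exact (norm_nonneg _).trans (ht σ)
  have h2 : |(Algebra.norm ℚ y : ℝ)| ≤ t ^ Module.finrank ℚ K := by
    have h3 : ‖algebraMap ℚ ℂ (Algebra.norm ℚ y)‖ = |(Algebra.norm ℚ y : ℝ)| := by
      rw [eq_ratCast, ← Complex.ofReal_ratCast, Complex.norm_real, Real.norm_eq_abs]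
    rw [← h3, Algebra.norm_eq_prod_embeddings, norm_prod, ← AlgHom.card ℚ K ℂ,
      ← Finset.card_univ, ← Finset.prod_const]
    exact Finset.prod_le_prod (fun _ _ => norm_nonneg _) fun σ _ => ht σ
  have hD : 0 < |(discr K : ℝ)| := abs_pos.mpr (Int.cast_ne_zero.mpr (discr_ne_zero K))
  have h4 : |(discr K : ℝ)|⁻¹ ≤ t ^ Module.finrank ℚ K := by
    rw [inv_le_iff_one_le_mul₀ hD]
    exact h1.trans (mul_le_mul_of_nonneg_right h2 hD.le)
  rw [← Real.inv_rpow hD.le, one_div]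
  exact (Real.rpow_le_rpow (by positivity) h4 (by positivity)).trans
    (Real.pow_rpow_inv_natCast ht0 hn).le

/-- If the real vector `e` of the space `ℂ ^ n` indexed by the embeddings represents the functional
`y ↦ Tr(v y)` on `K`, then the conjugates of `v` are bounded by `‖e‖`. On `K`, the real functional
given by `e` agrees with the complex combination of the embeddings whose coefficient at `σ` is the
mean of the conjugate of `e σ` and of the entry of `e` at the conjugate of `σ`; by the linear
independence of the embeddings this coefficient is `σ v`. -/
theorem norm_embedding_le_of_forall_trace_eq {K : Type*} [Field K] [NumberField K] (v : K)
    (e : PiLp 2 (fun _ : K →ₐ[ℚ] ℂ => ℂ))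
    (h : ∀ y : K, (Algebra.trace ℚ K (v * y) : ℝ) =
      ⟪e, WithLp.toLp 2 (fun σ : K →ₐ[ℚ] ℂ => σ y)⟫_ℝ) (σ : K →ₐ[ℚ] ℂ) :
    ‖σ v‖ ≤ ‖e‖ := by
  classical
  -- complex conjugation on the embeddings
  let J : (K →ₐ[ℚ] ℂ) → (K →ₐ[ℚ] ℂ) := fun σ =>
    (Complex.conjAe.restrictScalars ℚ : ℂ →ₐ[ℚ] ℂ).comp σ
  have hJ : ∀ σ y, J σ y = starRingEnd ℂ (σ y) := fun σ y => rfl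
  have hJJ : Function.Involutive J := by
    intro σ
    ext y
    simp [hJ]
  have h1 : ∀ y : K, ∑ σ : K →ₐ[ℚ] ℂ,
      (σ v - (starRingEnd ℂ (e σ) + e (J σ)) / 2) * σ y = 0 := by
    intro y
    have h2 : ∑ σ : K →ₐ[ℚ] ℂ, e (J σ) * σ y = ∑ σ : K →ₐ[ℚ] ℂ, e σ * starRingEnd ℂ (σ y) := by
      refine Fintype.sum_equiv hJJ.toPerm _ _ fun σ => ?_
      simp [hJ]
    have h3 : ((Algebra.trace ℚ K (v * y) : ℝ) : ℂ) = ∑ σ : K →ₐ[ℚ] ℂ, σ v * σ y := by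
      have := trace_eq_sum_embeddings (K := ℚ) ℂ (x := v * y)
      simpa using this
    rw [h y, PiLp.inner_apply, Complex.ofReal_sum] at h3
    have h4 : ∑ σ : K →ₐ[ℚ] ℂ, (σ v - (starRingEnd ℂ (e σ) + e (J σ)) / 2) * σ y =
        ∑ σ : K →ₐ[ℚ] ℂ, σ v * σ y -
          (∑ σ : K →ₐ[ℚ] ℂ, starRingEnd ℂ (e σ) * σ y + ∑ σ : K →ₐ[ℚ] ℂ, e (J σ) * σ y) / 2 := by
      rw [← Finset.sum_add_distrib, Finset.sum_div, ← Finset.sum_sub_distrib]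
      exact Finset.sum_congr rfl fun σ _ => by ring
    rw [h4, h2, ← h3, ← Finset.sum_add_distrib, Finset.sum_div, ← Finset.sum_sub_distrib]
    refine Finset.sum_eq_zero fun σ _ => ?_
    rw [Complex.inner, Complex.re_eq_add_conj]
    simp
    ring
  have h2 := linearIndependent_toLinearMap ℚ K ℂ
  have h3 := Fintype.linearIndependent_iff.mp h2
    (fun σ => σ v - (starRingEnd ℂ (e σ) + e (J σ)) / 2) (by
      ext y
      simpa using h1 y) σ
  rw [sub_eq_zero.mp h3]
  have h4 : ∀ σ, ‖e σ‖ ≤ ‖e‖ := fun σ => PiLp.norm_apply_le e σ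
  calc _ ≤ (‖starRingEnd ℂ (e σ)‖ + ‖e (J σ)‖) / 2 := by
        rw [norm_div, Complex.norm_two]
        gcongr
        exact norm_add_le _ _
    _ ≤ (‖e‖ + ‖e‖) / 2 := by
        rw [Complex.norm_conj]
        gcongr <;> apply h4
    _ = ‖e‖ := by ring

/-- The ring of integers contains a `ℚ`-basis of `K` all of whose conjugates are
`O(|Δ| ^ (1 / n))`, with an implied constant depending only on the degree. This is the transference
principle for the dual of the ring of integers under the trace form, whose dual lattice is the ring
of integers itself. -/
theorem exists_linearIndependent_integers_norm_le (n : ℕ) : ∃ C : ℝ, 0 ≤ C ∧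
    ∀ (K : Type*) [Field K] [NumberField K], Module.finrank ℚ K = n →
      ∃ v : Fin n → 𝓞 K, LinearIndependent ℚ (fun i => (v i : K)) ∧
        ∀ i (σ : K →ₐ[ℚ] ℂ), ‖σ (v i)‖ ≤ C * |(discr K : ℝ)| ^ (1 / (n : ℝ)) := by
  classical
  obtain ⟨C, hC0, hC⟩ := exists_short_dual_family n
  refine ⟨C, hC0, fun K _ _ hn => ?_⟩
  set ι := Module.Free.ChooseBasisIndex ℤ (𝓞 K)
  set ω := integralBasis K with hω
  set ω' := (Algebra.traceForm ℚ K).dualBasis (traceForm_nondegenerate ℚ K) ω with hω'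
  have htr : ∀ i j, Algebra.trace ℚ K (ω i * ω' j) = if i = j then 1 else 0 := fun i j =>
    (Algebra.traceForm ℚ K).apply_dualBasis_right (traceForm_nondegenerate ℚ K)
      (Algebra.traceForm_isSymm ℚ) ω i j
  -- the lattice dual to the ring of integers under the trace form
  let Y : (ι → ℤ) →+ K := (Fintype.linearCombination ℤ ω').toAddMonoidHom
  have hY : ∀ z, Y z = ∑ j, z j • ω' j := fun z => Fintype.linearCombination_apply ℤ ω' z
  have hYω : ∀ z i, Algebra.trace ℚ K (ω i * Y z) = z i := by
    intro z i
    rw [hY, Finset.mul_sum, map_sum]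
    simp_rw [mul_smul_comm, map_zsmul, htr]
    simp
  have hYint : ∀ z (x : 𝓞 K), ∃ k : ℤ, Algebra.trace ℚ K (Y z * x) = k := by
    intro z x
    refine ⟨∑ i, (RingOfIntegers.basis K).repr x i * z i, ?_⟩
    have hx : (x : K) = ∑ i, (RingOfIntegers.basis K).repr x i • ω i := by
      conv_lhs => rw [← (RingOfIntegers.basis K).sum_repr x]
      simp [hω, integralBasis_apply]
    rw [hx, mul_comm, Finset.sum_mul, map_sum]
    simp_rw [smul_mul_assoc, map_zsmul, hYω]
    simp
  have hY0 : ∀ z, z ≠ 0 → Y z ≠ 0 := by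
    intro z hz h0
    refine hz (funext fun i => ?_)
    have := hYω z i
    rw [h0] at this
    simpa using this.symm
  let F : K →+ PiLp 2 (fun _ : K →ₐ[ℚ] ℂ => ℂ) :=
    { toFun := fun y => WithLp.toLp 2 (fun σ : K →ₐ[ℚ] ℂ => σ y)
      map_zero' := by ext; simp
      map_add' := fun _ _ => by ext; simp }
  set m : ℝ := (|(discr K : ℝ)| ^ (1 / (n : ℝ)))⁻¹ with hm
  have hD : 0 < |(discr K : ℝ)| := abs_pos.mpr (Int.cast_ne_zero.mpr (discr_ne_zero K))
  have hrank : Module.finrank ℤ (ι → ℤ) = n := by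
    rw [Module.finrank_fintype_fun_eq_card, ← Module.finrank_eq_card_basis ω, hn]
  obtain ⟨b, e, hspan, hpair, hnorm⟩ := hC _ (ι → ℤ) hrank (F.comp Y) m (by positivity) (by
    intro z hz
    rw [hm, ← hn]
    exact inv_rpow_discr_le_of_forall_trace (hY0 z hz) (hYint z)
      fun σ => PiLp.norm_apply_le (F (Y z)) σ)
  -- the functionals represented by the `e k` are integral on the dual lattice, so they are the
  -- traces against elements `v k` of the ring of integers
  have hint : ∀ k z, ∃ c : ℤ, ⟪e k, F (Y z)⟫_ℝ = c := by
    intro k z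
    have h1 : z ∈ Submodule.span ℤ (Set.range b) := hspan ▸ trivial
    obtain ⟨c, rfl⟩ := (Submodule.mem_span_range_iff_exists_fun ℤ).mp h1
    refine ⟨c k, ?_⟩
    have h2 : ∀ j, ⟪e k, F (Y (c j • b j))⟫_ℝ = c j * ⟪e k, F (Y (b j))⟫_ℝ := by
      intro j
      rw [map_zsmul, map_zsmul, ← Int.cast_smul_eq_zsmul ℝ, real_inner_smul_right]
    have h3 : ∀ j, ⟪e k, F (Y (b j))⟫_ℝ = if k = j then 1 else 0 := hpair k
    rw [map_sum, map_sum, inner_sum]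
    simp_rw [h2, h3]
    simp
  choose c hc using hint
  set v : Fin n → 𝓞 K := fun k => ∑ j, c k (Pi.single j 1) • RingOfIntegers.basis K j with hv
  have hvK : ∀ k, (v k : K) = ∑ j, c k (Pi.single j 1) • ω j := by
    intro k
    simp [hv, hω, integralBasis_apply]
  have hve : ∀ k y, (Algebra.trace ℚ K (v k * y) : ℝ) = ⟪e k, F y⟫_ℝ := by
    intro k y
    let ψ₁ : K →+ ℝ := (Rat.castHom ℝ).toAddMonoidHom.comp
      ((Algebra.trace ℚ K).toAddMonoidHom.comp (AddMonoidHom.mulLeft (v k : K)))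
    let ψ₂ : K →+ ℝ := ((innerSL ℝ (e k) : _ →L[ℝ] ℝ) : _ →+ ℝ).comp F
    have h1 : ψ₁.toRatLinearMap = ψ₂.toRatLinearMap := by
      -- both functionals are `ℚ`-linear, so they may be compared on the dual basis
      refine ω'.ext fun j => ?_
      have h2 : Y (Pi.single j 1) = ω' j := by simp [hY, Pi.single_apply]
      change (Algebra.trace ℚ K (v k * ω' j) : ℝ) = ⟪e k, F (ω' j)⟫_ℝ
      rw [← h2, hc, hvK, h2, Finset.sum_mul, map_sum]
      simp_rw [smul_mul_assoc, map_zsmul, htr]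
      simp
    exact DFunLike.congr_fun h1 y
  refine ⟨v, ?_, ?_⟩
  · rw [Fintype.linearIndependent_iff]
    intro q hq j
    have h1 : Algebra.trace ℚ K ((∑ k, q k • (v k : K)) * Y (b j)) = q j := by
      have h2 : ∀ k, Algebra.trace ℚ K (v k * Y (b j)) = if k = j then 1 else 0 := by
        intro k
        have h3 : (Algebra.trace ℚ K (v k * Y (b j)) : ℝ) = if k = j then 1 else 0 :=
          (hve k _).trans (hpair k j)
        split_ifs at h3 ⊢ <;> exact_mod_cast h3
      rw [Finset.sum_mul, map_sum]
      simp [h2]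
    rw [← h1, hq, zero_mul, map_zero]
  · intro i σ
    refine (norm_embedding_le_of_forall_trace_eq _ (e i) (hve i) σ).trans ((hnorm i).trans ?_)
    rw [hm, div_inv_eq_mul]

end SmallIntegers

/-! ### Points at which a polynomial does not vanish -/

section Nonvanishing

open MvPolynomial

theorem eval_aeval_eq_eval {σ τ R : Type*} [CommRing R] (g : σ → MvPolynomial τ R) (x : τ → R)
    (p : MvPolynomial σ R) : eval x (aeval g p) = eval (fun i => eval x (g i)) p := by
  induction p using MvPolynomial.induction_on with
  | C a => simp
  | add p q hp hq => rw [map_add, map_add, map_add, hp, hq]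
  | mul_X p i hp => rw [map_mul, map_mul, map_mul, hp, aeval_X, eval_X]

theorem totalDegree_aeval_le_of_totalDegree_le_one {σ τ R : Type*} [CommRing R]
    (L : σ → MvPolynomial τ R) (hL : ∀ i, (L i).totalDegree ≤ 1) (Q : MvPolynomial σ R) :
    (aeval L Q).totalDegree ≤ Q.totalDegree := by
  rw [aeval_def, eval₂_eq]
  refine totalDegree_finsetSum_le fun d hd => ?_
  refine (totalDegree_mul _ _).trans ?_
  rw [algebraMap_eq, totalDegree_C, zero_add]
  refine (totalDegree_finsetProd _ _).trans (le_trans ?_ (le_totalDegree hd))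
  refine Finset.sum_le_sum fun i _ => (totalDegree_pow _ _).trans ?_
  exact (Nat.mul_le_mul_left _ (hL i)).trans (mul_one _).le

/-- A nonzero polynomial of total degree `d` in linearly transformed coordinates is nonzero at a
point whose coordinates are natural numbers at most `d`. The bound does not involve the
transformation `A`. -/
theorem exists_nat_le_totalDegree_eval_mulVec_ne_zero {n : ℕ} {Q : MvPolynomial (Fin n) ℂ}
    (hQ : Q ≠ 0) {A : Matrix (Fin n) (Fin n) ℂ} (hA : IsUnit A.det) :
    ∃ c : Fin n → ℕ, (∀ k, c k ≤ Q.totalDegree) ∧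
      eval (A.mulVec fun k => (c k : ℂ)) Q ≠ 0 := by
  classical
  set L : Fin n → MvPolynomial (Fin n) ℂ := fun i => ∑ k, C (A i k) * X k with hL
  have heval : ∀ x, eval x (aeval L Q) = eval (A.mulVec x) Q := by
    intro x
    rw [eval_aeval_eq_eval]
    refine congrArg (fun y => eval y Q) (funext fun i => ?_)
    simp [hL, Matrix.mulVec, dotProduct]
  have hP : aeval L Q ≠ 0 := by
    intro h0
    refine hQ (MvPolynomial.funext fun x => ?_)
    have := heval (A⁻¹.mulVec x)
    rw [Matrix.mulVec_mulVec, Matrix.mul_nonsing_inv _ hA, Matrix.one_mulVec, h0] at this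
    rw [← this, map_zero, map_zero]
  have hdeg : ∀ i, (aeval L Q).degreeOf i < ((Finset.range (Q.totalDegree + 1)).image
      (fun k : ℕ => (k : ℂ))).card := by
    intro i
    rw [Finset.card_image_of_injective _ Nat.cast_injective, Finset.card_range, Nat.lt_succ_iff]
    refine (degreeOf_le_totalDegree _ _).trans
      (totalDegree_aeval_le_of_totalDegree_le_one L (fun i => ?_) Q)
    refine totalDegree_finsetSum_le fun k _ => (totalDegree_mul _ _).trans ?_
    rw [totalDegree_C, totalDegree_X]
  by_contra! hc
  refine hP (eq_zero_of_eval_zero_at_prod_finset _ _ hdeg fun x hx => ?_)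
  simp only [Finset.mem_image, Finset.mem_range, Nat.lt_succ_iff] at hx
  choose c hcD hcx using hx
  obtain rfl : (fun k => (c k : ℂ)) = x := funext hcx
  rw [heval]
  exact hc c hcD

end Nonvanishing

/-! ### Nondegenerate points in the fibres of a polynomial map -/

section Fibers

open MvPolynomial Filter Topology

/-- Each coordinate satisfies a nontrivial polynomial relation over the ring generated by `n` given
polynomials in `n` variables, by comparison of transcendence degrees. The coefficients of `P` are
polynomials in the values of the `f i`. -/
theorem exists_polynomial_relation {n : ℕ} (f : Fin n → MvPolynomial (Fin n) ℂ) (l : Fin n) :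
    ∃ P : Polynomial (MvPolynomial (Fin n) ℂ), P ≠ 0 ∧
      ∀ x : Fin n → ℂ, (P.map (eval fun i => eval x (f i))).eval (x l) = 0 := by
  set g : Fin (n + 1) → MvPolynomial (Fin n) ℂ := Fin.cons (X l) f with hg
  have hdep : ¬ AlgebraicIndependent ℂ g := by
    intro h
    have h1 := h.lift_cardinalMk_le_trdeg
    rw [MvPolynomial.trdeg_of_isDomain] at h1
    simp only [Cardinal.mk_fin, Cardinal.lift_natCast, Nat.cast_le] at h1
    omega
  rw [algebraicIndependent_iff] at hdep
  push Not at hdep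
  obtain ⟨p, hp0, hp⟩ := hdep
  refine ⟨finSuccEquiv ℂ n p, by simpa using hp, fun x => ?_⟩
  rw [← eval_eq_eval_mv_eval']
  have h2 : (Fin.cons (x l) fun i => eval x (f i) : Fin (n + 1) → ℂ) = fun i => eval x (g i) := by
    funext i
    refine Fin.cases ?_ (fun i => ?_) i <;> simp [hg]
  rw [h2, ← eval_aeval_eq_eval, hp0, map_zero]

theorem hasStrictFDerivAt_eval {n : ℕ} (p : MvPolynomial (Fin n) ℂ) (x : Fin n → ℂ) :
    HasStrictFDerivAt (fun y : Fin n → ℂ => eval y p)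
      (∑ j, eval x (pderiv j p) • ContinuousLinearMap.proj (R := ℂ) (φ := fun _ => ℂ) j) x := by
  classical
  induction p using MvPolynomial.induction_on with
  | C a =>
    refine ((hasStrictFDerivAt_const (𝕜 := ℂ) a x).congr_of_eventuallyEq ?_).congr_fderiv ?_
    · exact Eventually.of_forall fun y => by simp
    · ext w
      simp
  | add p q hp hq =>
    refine ((hp.add hq).congr_of_eventuallyEq ?_).congr_fderiv ?_
    · exact Eventually.of_forall fun y => by simp
    · ext w
      simp [add_mul, Finset.sum_add_distrib]
  | mul_X p i hp =>
    have h1 := hp.mul (hasStrictFDerivAt_apply (𝕜 := ℂ) (F' := fun _ : Fin n => ℂ) i x)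
    refine (h1.congr_of_eventuallyEq ?_).congr_fderiv ?_
    · exact Eventually.of_forall fun y => by simp
    · ext w
      simp [pderiv_X, Pi.single_apply, add_mul, Finset.sum_add_distrib, Finset.mul_sum,
        mul_assoc, apply_ite (eval x)]

/-- The number of points of a fibre of a polynomial map `ℂ ^ n → ℂ ^ n` at which the Jacobian
determinant does not vanish is bounded uniformly in the fibre. Near each such point the map is open,
so a nearby generic fibre has at least as many points; and over a value where the leading
coefficients of the relations satisfied by the coordinates do not vanish, each coordinate takes
boundedly many values. -/
theorem exists_card_nondegenerate_fiber_le {n : ℕ} (f : Fin n → MvPolynomial (Fin n) ℂ) :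
    ∃ D : ℕ, ∀ (v : Fin n → ℂ) (s : Finset (Fin n → ℂ)),
      (∀ x ∈ s, (∀ i, eval x (f i) = v i) ∧
        eval x (Matrix.of fun i j => pderiv j (f i)).det ≠ 0) → s.card ≤ D := by
  classical
  choose P hP0 hP using exists_polynomial_relation f
  refine ⟨∏ l, (P l).natDegree, fun v s hs => ?_⟩
  set F : (Fin n → ℂ) → (Fin n → ℂ) := fun x i => eval x (f i) with hF
  have hmap : ∀ x ∈ s, map F (𝓝 x) = 𝓝 v := by
    intro x hx
    obtain ⟨hxv, hdet⟩ := hs x hx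
    have h1 : HasStrictFDerivAt F (ContinuousLinearMap.pi fun i => ∑ j, eval x (pderiv j (f i)) •
        ContinuousLinearMap.proj (R := ℂ) (φ := fun _ => ℂ) j) x :=
      hasStrictFDerivAt_pi.mpr fun i => hasStrictFDerivAt_eval (f i) x
    rw [h1.map_nhds_eq_of_surj, show F x = v from funext hxv]
    rw [LinearMap.range_eq_top]
    intro w
    set J : Matrix (Fin n) (Fin n) ℂ := Matrix.of fun i j => eval x (pderiv j (f i)) with hJ
    have hJdet : IsUnit J.det := by
      rw [isUnit_iff_ne_zero]
      rw [RingHom.map_det] at hdet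
      exact hdet
    refine ⟨J⁻¹.mulVec w, ?_⟩
    have h2 : J.mulVec (J⁻¹.mulVec w) = w := by
      rw [Matrix.mulVec_mulVec, Matrix.mul_nonsing_inv _ hJdet, Matrix.one_mulVec]
    conv_rhs => rw [← h2]
    ext i
    simp [hJ, Matrix.mulVec, dotProduct]
  -- disjoint neighbourhoods of the points of `s`
  obtain ⟨U, hU, hdisj⟩ := s.finite_toSet.t2_separation
  have hV : (⋂ x ∈ s, F '' U x) ∈ 𝓝 v := by
    refine (Filter.biInter_finset_mem s).mpr fun x hx => ?_
    rw [← hmap x hx]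
    exact image_mem_map ((hU x).2.mem_nhds (hU x).1)
  -- a nearby value at which no leading coefficient vanishes
  obtain ⟨y, hyV, hy⟩ : ∃ y ∈ ⋂ x ∈ s, F '' U x, eval y (∏ l, (P l).leadingCoeff) ≠ 0 := by
    obtain ⟨ε, hε, hball⟩ := Metric.mem_nhds_iff.mp hV
    by_contra! h
    have h0 : ∏ l, (P l).leadingCoeff ≠ 0 :=
      Finset.prod_ne_zero_iff.mpr fun l _ => Polynomial.leadingCoeff_ne_zero.mpr (hP0 l)
    refine h0 (funext_set (fun i => Metric.ball (v i) ε) (fun i => ?_) fun y hy => ?_)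
    · exact infinite_of_mem_nhds _ (Metric.ball_mem_nhds _ hε)
    · rw [map_zero]
      refine h y (hball ?_)
      rw [ball_pi _ hε]
      exact hy
  simp only [map_prod, ne_eq, Finset.prod_eq_zero_iff, Finset.mem_univ, true_and, not_exists] at hy
  simp only [Set.mem_iInter] at hyV
  choose! q hqU hqy using hyV
  have hinj : Set.InjOn q s := by
    intro x hx x' hx' h
    by_contra hne
    exact Set.disjoint_left.mp (hdisj hx hx' hne) (hqU x hx) (h ▸ hqU x' hx')
  have hPy : ∀ l, (P l).map (eval y) ≠ 0 := by
    intro l h0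
    have := congrArg (fun p => Polynomial.coeff p (P l).natDegree) h0
    rw [Polynomial.coeff_map] at this
    exact hy l this
  calc s.card = (s.image q).card := (Finset.card_image_of_injOn hinj).symm
    _ ≤ (Fintype.piFinset fun l => ((P l).map (eval y)).roots.toFinset).card := by
        refine Finset.card_le_card fun z hz => ?_
        obtain ⟨x, hx, rfl⟩ := Finset.mem_image.mp hz
        refine Fintype.mem_piFinset.mpr fun l => ?_
        rw [Multiset.mem_toFinset, Polynomial.mem_roots (hPy l), Polynomial.IsRoot.def,
          ← hqy x hx]
        exact hP l (q x)
    _ = ∏ l, ((P l).map (eval y)).roots.toFinset.card := Fintype.card_piFinset _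
    _ ≤ ∏ l, (P l).natDegree := by
        refine Finset.prod_le_prod' fun l _ => (Multiset.toFinset_card_le _).trans ?_
        exact (Polynomial.card_roots' _).trans Polynomial.natDegree_map_le

end Fibers

open NumberField NumberFieldCount
open MvPolynomial (eval aeval pderiv)

/-! ### Trace functions at the conjugates of an algebraic integer -/

/-- The permutations attached to the normalizer commute with `G`: right multiplication on the cosets
commutes with left multiplication. -/
theorem assocPerm_smul {n : ℕ} [NeZero n] (G : Subgroup (Equiv.Perm (Fin n)))
    [MulAction.IsPretransitive G (Fin n)] (ν : stabilizerNormalizer G) (h : G) (i : Fin n) :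
    assocPerm G ν (h • i) = h • assocPerm G ν i := by
  obtain ⟨γ, rfl⟩ := MulAction.exists_smul_eq G (0 : Fin n) i
  rw [smul_smul, assocPerm_apply, assocPerm_apply, mul_assoc, mul_smul]

theorem aeval_traceFunction {n r : ℕ} [NeZero n] (G : Subgroup (Equiv.Perm (Fin n)))
    [MulAction.IsPretransitive G (Fin n)] (g : Fin r → stabilizerNormalizer G) (a : Fin r → ℕ)
    {R : Type*} [CommRing R] [Algebra ℤ R] (y : Fin n → R) :
    aeval y (traceFunction G g a) = ∑ i, ∏ j, y (assocPerm G (g j) i) ^ a j := by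
  simp [traceFunction]

theorem aeval_traceFunction_smul {n r : ℕ} [NeZero n] (G : Subgroup (Equiv.Perm (Fin n)))
    [MulAction.IsPretransitive G (Fin n)] (g : Fin r → stabilizerNormalizer G) (a : Fin r → ℕ)
    {R : Type*} [CommRing R] [Algebra ℤ R] (y : Fin n → R) (h : G) :
    aeval (fun i => y (h • i)) (traceFunction G g a) = aeval y (traceFunction G g a) := by
  rw [aeval_traceFunction, aeval_traceFunction]
  refine Fintype.sum_equiv (MulAction.toPerm h) _ _ fun i => ?_
  simp only [MulAction.toPerm_apply, assocPerm_smul]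

theorem norm_aeval_traceFunction_le {n r : ℕ} [NeZero n] (G : Subgroup (Equiv.Perm (Fin n)))
    [MulAction.IsPretransitive G (Fin n)] (g : Fin r → stabilizerNormalizer G) (a : Fin r → ℕ)
    (x : Fin n → ℂ) {ρ : ℝ} (hx : ∀ i, ‖x i‖ ≤ ρ) :
    ‖aeval x (traceFunction G g a)‖ ≤ n * ρ ^ height a := by
  rw [aeval_traceFunction]
  refine (norm_sum_le_of_le _ (f := fun i => ∏ j, x (assocPerm G (g j) i) ^ a j)
    (n := fun _ => ρ ^ height a) fun i _ => ?_).trans (by simp)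
  rw [norm_prod, height, ← Finset.prod_pow_eq_pow_sum]
  refine Finset.prod_le_prod (fun _ _ => norm_nonneg _) fun j _ => ?_
  rw [norm_pow]
  exact pow_le_pow_left₀ (norm_nonneg _) (hx _) _

theorem exists_int_of_isIntegral_of_fixed {L : Type*} [Field L] [Algebra ℚ L]
    [FiniteDimensional ℚ L] [IsGalois ℚ L] {z : L} (hz : IsIntegral ℤ z)
    (hfix : ∀ σ : L ≃ₐ[ℚ] L, σ z = z) : ∃ k : ℤ, z = k := by
  obtain ⟨q, rfl⟩ := (IsGalois.mem_range_algebraMap_iff_fixed z).mpr hfix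
  have hq : IsIntegral ℤ q := (isIntegral_algebraMap_iff (algebraMap ℚ L).injective).mp hz
  obtain ⟨k, rfl⟩ := IsIntegrallyClosed.isIntegral_iff.mp hq
  exact ⟨k, by simp⟩

/-- The trace functions take rational integral values at the conjugates of an algebraic integer,
labelled compatibly with the Galois action. -/
theorem exists_int_aeval_traceFunction_conjugates {n r : ℕ} [NeZero n]
    {K : IntermediateField ℚ (AlgebraicClosure ℚ)} [NumberField K]
    {G : Subgroup (Equiv.Perm (Fin n))}
    [MulAction.IsPretransitive G (Fin n)] (g : Fin r → stabilizerNormalizer G) (a : Fin r → ℕ)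
    (φ : (galoisClosure K ≃ₐ[ℚ] galoisClosure K) ≃* G)
    (b : (K →ₐ[ℚ] galoisClosure K) ≃ Fin n)
    (hb : ∀ (σ : galoisClosure K ≃ₐ[ℚ] galoisClosure K) (τ : K →ₐ[ℚ] galoisClosure K),
      b ((σ : galoisClosure K →ₐ[ℚ] galoisClosure K).comp τ) = φ σ • b τ)
    (α : 𝓞 K) :
    ∃ k : ℤ, aeval (fun i => b.symm i (α : K)) (traceFunction G g a) = (k : galoisClosure K) := by
  -- `AlgebraicClosure ℚ` is a `ℚ`-algebra here through characteristic zero, which agrees with the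
  -- structure given by its construction only up to unfolding: instance search misses these facts
  have hAC : IsAlgClosure ℚ (AlgebraicClosure ℚ) :=
    ⟨inferInstance, AlgebraicClosure.isAlgebraic ℚ⟩
  have : Normal ℚ (AlgebraicClosure ℚ) := IsAlgClosure.normal ℚ (AlgebraicClosure ℚ)
  have : Normal ℚ (galoisClosure K) := normalClosure.normal ℚ K (AlgebraicClosure ℚ)
  have : IsGalois ℚ (galoisClosure K) := ⟨⟩
  refine exists_int_of_isIntegral_of_fixed ?_ fun σ => ?_
  · rw [aeval_traceFunction]
    refine IsIntegral.sum _ fun i _ => IsIntegral.prod _ fun j _ => IsIntegral.pow ?_ _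
    exact (RingOfIntegers.isIntegral_coe α).map ((b.symm _).restrictScalars ℤ)
  · have h1 : ∀ i, σ (b.symm i (α : K)) = b.symm (φ σ • i) (α : K) := by
      intro i
      have h2 := hb σ (b.symm i)
      rw [b.apply_symm_apply, ← b.eq_symm_apply] at h2
      rw [← h2]
      rfl
    conv_rhs => rw [← aeval_traceFunction_smul G g a _ (φ σ), aeval_traceFunction]
    rw [aeval_traceFunction, map_sum]
    simp only [map_prod, map_pow, h1]

theorem exists_equiv_embeddings {n : ℕ} {K : IntermediateField ℚ (AlgebraicClosure ℚ)}
    [NumberField K] (ι : AlgebraicClosure ℚ →ₐ[ℚ] ℂ)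
    (hn : Module.finrank ℚ K = n) (b : (K →ₐ[ℚ] galoisClosure K) ≃ Fin n) :
    ∃ e : Fin n ≃ (K →ₐ[ℚ] ℂ), ∀ i α, e i α = ι (b.symm i α) := by
  let F : Fin n → (K →ₐ[ℚ] ℂ) := fun i => (ι.comp (galoisClosure K).val).comp (b.symm i)
  have hinj : Function.Injective F := by
    intro i j hij
    refine b.symm.injective (AlgHom.ext fun α => ?_)
    have h1 : F i α = F j α := by rw [hij]
    exact Subtype.val_injective (ι.toRingHom.injective h1)
  have hbij : Function.Bijective F := by
    rw [Fintype.bijective_iff_injective_and_card]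
    exact ⟨hinj, by rw [Fintype.card_fin, AlgHom.card, hn]⟩
  exact ⟨Equiv.ofBijective F hbij, fun i α => rfl⟩

/-- A nonzero polynomial `Q` is nonzero at the conjugates of some algebraic integer which is a
combination of given independent integers `v`, with coefficients bounded by the degree of `Q`. -/
theorem exists_integer_eval_conjugates_ne_zero {K : Type*} [Field K] [NumberField K] {n : ℕ}
    (e : Fin n ≃ (K →ₐ[ℚ] ℂ)) {v : Fin n → 𝓞 K} (hv : LinearIndependent ℚ (fun i => (v i : K)))
    {ρ : ℝ} (hρ : ∀ i (σ : K →ₐ[ℚ] ℂ), ‖σ (v i)‖ ≤ ρ) {Q : MvPolynomial (Fin n) ℂ} (hQ : Q ≠ 0) :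
    ∃ α : 𝓞 K, eval (fun i => e i α) Q ≠ 0 ∧ ∀ i, ‖e i α‖ ≤ n * (Q.totalDegree * ρ) := by
  have hcard : Fintype.card (Fin n) = Module.finrank ℚ K := by
    rw [Fintype.card_congr e, AlgHom.card]
  rcases Nat.eq_zero_or_pos n with rfl | hn
  · rw [Fintype.card_fin] at hcard
    exact absurd hcard.symm Module.finrank_pos.ne'
  have : Nonempty (Fin n) := ⟨⟨0, hn⟩⟩
  set A : Matrix (Fin n) (Fin n) ℂ := Matrix.of fun i k => e i (v k) with hA
  -- the square of the determinant of `A` is the discriminant of the basis `v`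
  have hdet : IsUnit A.det := by
    rw [isUnit_iff_ne_zero]
    intro h0
    have h1 := Algebra.discr_eq_det_embeddingsMatrixReindex_pow_two ℚ ℂ (fun i => (v i : K)) e
    have h2 : Algebra.embeddingsMatrixReindex ℚ ℂ (fun i => (v i : K)) e = A.transpose := by
      ext i j
      rfl
    rw [h2, Matrix.det_transpose, h0, zero_pow two_ne_zero, map_eq_zero] at h1
    have h3 := Algebra.discr_not_zero_of_basis ℚ (basisOfLinearIndependentOfCardEqFinrank hv hcard)
    rw [coe_basisOfLinearIndependentOfCardEqFinrank] at h3
    exact h3 h1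
  obtain ⟨c, hcD, hc⟩ := exists_nat_le_totalDegree_eval_mulVec_ne_zero hQ hdet
  have hval : ∀ i, e i ((∑ k, c k • v k : 𝓞 K) : K) = A.mulVec (fun k => (c k : ℂ)) i := by
    intro i
    simp [hA, Matrix.mulVec, dotProduct, mul_comm]
  refine ⟨∑ k, c k • v k, ?_, fun i => ?_⟩
  · rwa [show (fun i => e i ((∑ k, c k • v k : 𝓞 K) : K)) = _ from funext hval]
  · rw [hval]
    calc ‖∑ k, A i k * (c k : ℂ)‖ ≤ ∑ _k : Fin n, (Q.totalDegree * ρ : ℝ) := by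
          refine norm_sum_le_of_le _ fun k _ => ?_
          rw [norm_mul, mul_comm, Complex.norm_natCast]
          exact mul_le_mul (Nat.cast_le.mpr (hcD k)) (hρ k (e i)) (norm_nonneg _)
            (Nat.cast_nonneg _)
      _ = _ := by simp

theorem adjoin_eq_of_injective_conjugates {K : IntermediateField ℚ (AlgebraicClosure ℚ)}
    [NumberField K] {n : ℕ} (e : Fin n ≃ (K →ₐ[ℚ] ℂ)) {α : K}
    (h : Function.Injective fun i => e i α) :
    IntermediateField.adjoin ℚ {(α : AlgebraicClosure ℚ)} = K := by
  have h1 : IntermediateField.adjoin ℚ {α} = ⊤ := by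
    rw [Field.primitive_element_iff_algHom_eq_of_eval' ℚ ℂ (fun _ => IsAlgClosed.splits _)]
    intro σ τ hστ
    rw [← e.apply_symm_apply σ, ← e.apply_symm_apply τ] at hστ ⊢
    rw [h hστ]
  have h2 : @IntermediateField.adjoin ℚ _ K _ K.algebra' {α} = ⊤ := h1
  rw [← IntermediateField.lift_adjoin_simple, h2, IntermediateField.lift_top]

/-! ### The point attached to a number field -/

/-- The Jacobian determinant of `n` integral polynomials in `n` variables, as a complex
polynomial. -/
noncomputable def complexJacobian {n : ℕ} (f : Fin n → MvPolynomial (Fin n) ℤ) :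
    MvPolynomial (Fin n) ℂ :=
  (Matrix.of fun i j => pderiv j (MvPolynomial.map (Int.castRingHom ℂ) (f i))).det

theorem complexJacobian_ne_zero {n : ℕ} {f : Fin n → MvPolynomial (Fin n) ℤ}
    (hf : (jacobianMatrix f).det ≠ 0) : complexJacobian f ≠ 0 := by
  have h1 : complexJacobian f = MvPolynomial.map (Int.castRingHom ℂ) (jacobianMatrix f).det := by
    rw [complexJacobian, RingHom.map_det]
    congr 1
    ext1 i j
    exact MvPolynomial.pderiv_map
  rw [h1, Ne, map_eq_zero_iff _
    (MvPolynomial.map_injective _ (RingHom.injective_int (Int.castRingHom ℂ)))]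
  exact hf

theorem eval_map_intCast {n : ℕ} (x : Fin n → ℂ) (p : MvPolynomial (Fin n) ℤ) :
    eval x (MvPolynomial.map (Int.castRingHom ℂ) p) = aeval x p := by
  rw [MvPolynomial.eval_map, MvPolynomial.aeval_def]
  rfl

/-- Each field `K` counted by `N_n(X; G)` has an integral generator whose conjugates `x` have
absolute value `O(X ^ (1 / n))`, give integral values to the trace functions, and are a
nondegenerate point of the map given by these. The field is recovered from `x` and from
the letter at which the generator itself, rather than another conjugate, occurs. -/
theorem exists_point_of_mem_fieldsWithGroup {n r : ℕ} [NeZero n]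
    (ι : AlgebraicClosure ℚ →ₐ[ℚ] ℂ) (a : Fin n → Fin r → ℕ)
    (G : Subgroup (Equiv.Perm (Fin n))) [MulAction.IsPretransitive G (Fin n)]
    (g : Fin r → stabilizerNormalizer G)
    (hJ : (jacobianMatrix fun i => traceFunction G g (a i)).det ≠ 0) :
    ∃ R : ℝ, 0 ≤ R ∧ ∀ (X : ℝ) (K : IntermediateField ℚ (AlgebraicClosure ℚ)),
      K ∈ fieldsWithGroup G X → ∃ (x : Fin n → ℂ) (k : Fin n → ℤ),
        (∀ i, aeval x (traceFunction G g (a i)) = k i) ∧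
        eval x (complexJacobian fun i => traceFunction G g (a i)) ≠ 0 ∧
        (∀ i, ‖x i‖ ≤ R * X ^ (1 / (n : ℝ))) ∧
        ∃ (i : Fin n) (α : AlgebraicClosure ℚ), ι α = x i ∧ IntermediateField.adjoin ℚ {α} = K := by
  obtain ⟨C, hC0, hC⟩ := exists_linearIndependent_integers_norm_le n
  -- nonvanishing of the Vandermonde determinant makes the conjugates distinct
  set V : MvPolynomial (Fin n) ℂ := (Matrix.vandermonde MvPolynomial.X).det with hV
  have hV0 : V ≠ 0 := Matrix.det_vandermonde_ne_zero_iff.mpr MvPolynomial.X_injective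
  set Q := (complexJacobian fun i => traceFunction G g (a i)) * V with hQ
  have hQ0 : Q ≠ 0 := mul_ne_zero (complexJacobian_ne_zero hJ) hV0
  refine ⟨n * (Q.totalDegree * C), by positivity, ?_⟩
  rintro X K ⟨hK, hn, hX, φ, b, hb⟩
  obtain ⟨v, hv, hvC⟩ := hC K hn
  obtain ⟨e, he⟩ := exists_equiv_embeddings ι hn b
  obtain ⟨α, hαQ, hαn⟩ := exists_integer_eval_conjugates_ne_zero e hv hvC hQ0
  rw [hQ, map_mul] at hαQ
  obtain ⟨hαJ, hαV⟩ := ne_zero_and_ne_zero_of_mul hαQ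
  have hinj : Function.Injective fun i => e i (α : K) := by
    rw [hV, RingHom.map_det] at hαV
    refine Matrix.det_vandermonde_ne_zero_iff.mp ?_
    convert! hαV using 2
    ext i j
    simp [Matrix.vandermonde_apply]
  choose k hk using fun i => exists_int_aeval_traceFunction_conjugates g (a i) φ b hb α
  refine ⟨fun i => e i α, k, fun i => ?_, hαJ, fun i => ?_, ?_⟩
  · have h1 := congrArg (fun z : galoisClosure K => ι z) (hk i)
    rw [aeval_traceFunction] at h1 ⊢
    simp only [he]
    simpa using h1
  · refine (hαn i).trans ?_
    rw [mul_assoc, mul_assoc]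
    gcongr
  · -- the letter of the inclusion of `K` in its Galois closure
    let τ : K →ₐ[ℚ] galoisClosure K :=
      (IntermediateField.inclusion K.le_normalClosure).toRingHom.toRatAlgHom
    refine ⟨b τ, α, ?_, adjoin_eq_of_injective_conjugates e hinj⟩
    change ι _ = e (b τ) α
    rw [he, b.symm_apply_apply]
    rfl

/-! ### Counting -/

theorem Set.finite_and_ncard_le_of_forall_finset {α : Type*} {s : Set α} {N : ℕ}
    (h : ∀ t : Finset α, (t : Set α) ⊆ s → t.card ≤ N) : s.Finite ∧ s.ncard ≤ N := by
  have hfin : s.Finite := by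
    by_contra hinf
    obtain ⟨t, ht, hcard⟩ := Set.Infinite.exists_subset_card_eq hinf (N + 1)
    have := h t ht
    omega
  refine ⟨hfin, ?_⟩
  rw [Set.ncard_eq_toFinset_card s hfin]
  exact h _ (by simp)

/-- The number of integral vectors satisfying the bounds for the values of the trace functions. -/
theorem card_integer_box_le {n : ℕ} (R X : ℝ) (hR : 0 ≤ R) (hX : 1 ≤ X) (H : Fin n → ℕ) :
    ((Fintype.piFinset fun i => Finset.Icc (-⌊n * (R * X ^ (1 / (n : ℝ))) ^ H i⌋)
      ⌊n * (R * X ^ (1 / (n : ℝ))) ^ H i⌋).card : ℝ) ≤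
      (∏ i, (2 * n * R ^ H i + 1)) * X ^ ((1 / (n : ℝ)) * ∑ i, (H i : ℝ)) := by
  have h1 : X ^ ((1 / (n : ℝ)) * ∑ i, (H i : ℝ)) = ∏ i, (X ^ (1 / (n : ℝ))) ^ H i := by
    rw [Finset.prod_pow_eq_pow_sum, Real.rpow_mul (by linarith), ← Nat.cast_sum, Real.rpow_natCast]
  rw [h1, ← Finset.prod_mul_distrib, Fintype.card_piFinset, Nat.cast_prod]
  refine Finset.prod_le_prod (fun _ _ => Nat.cast_nonneg _) fun i _ => ?_
  set Y := X ^ (1 / (n : ℝ))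
  have hY : 1 ≤ Y := Real.one_le_rpow hX (by positivity)
  set B : ℝ := n * (R * Y) ^ H i with hB
  have hB0 : 0 ≤ B := by positivity
  have h2 : ((Finset.Icc (-⌊B⌋) ⌊B⌋).card : ℝ) = 2 * ⌊B⌋ + 1 := by
    have h3 : ((Finset.Icc (-⌊B⌋) ⌊B⌋).card : ℤ) = 2 * ⌊B⌋ + 1 := by
      have := Int.floor_nonneg.mpr hB0
      rw [Int.card_Icc]
      omega
    exact_mod_cast h3
  have h4 : 1 ≤ Y ^ H i := one_le_pow₀ hY
  calc _ = 2 * (⌊B⌋ : ℝ) + 1 := h2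
    _ ≤ 2 * B + 1 := by linarith [Int.floor_le B]
    _ ≤ 2 * B + Y ^ H i := by linarith
    _ = _ := by rw [hB, mul_pow]; ring

/-- The bound for a single group and a single choice of representatives. -/
theorem exists_countFields_le {n r : ℕ} [NeZero n] (a : Fin n → Fin r → ℕ)
    (G : Subgroup (Equiv.Perm (Fin n))) [MulAction.IsPretransitive G (Fin n)]
    (g : Fin r → stabilizerNormalizer G)
    (hJ : (jacobianMatrix fun i => traceFunction G g (a i)).det ≠ 0) :
    ∃ C : ℝ, ∀ X : ℝ, 0 < X → (fieldsWithGroup G X).Finite ∧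
      (countFields G X : ℝ) ≤ C * X ^ ((1 / (n : ℝ)) * ∑ i, (height (a i) : ℝ)) := by
  classical
  have : Algebra.IsAlgebraic ℚ (AlgebraicClosure ℚ) := AlgebraicClosure.isAlgebraic ℚ
  let ι : AlgebraicClosure ℚ →ₐ[ℚ] ℂ := IsAlgClosed.lift
  obtain ⟨R, hR0, hR⟩ := exists_point_of_mem_fieldsWithGroup ι a G g hJ
  obtain ⟨D, hD⟩ := exists_card_nondegenerate_fiber_le
    fun i => MvPolynomial.map (Int.castRingHom ℂ) (traceFunction G g (a i))
  refine ⟨(D * n : ℕ) * ∏ i, (2 * n * R ^ height (a i) + 1), fun X hX => ?_⟩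
  rcases lt_or_ge X 1 with hX1 | hX1
  · -- a nonzero integer has absolute value at least one, so there are no fields to count
    have h0 : fieldsWithGroup G X = ∅ := by
      refine Set.eq_empty_of_forall_notMem ?_
      rintro K ⟨_, -, hK, -⟩
      have h1 : (1 : ℝ) ≤ |(discr K : ℝ)| := by
        exact_mod_cast Int.one_le_abs (discr_ne_zero K)
      linarith
    rw [countFields, h0]
    refine ⟨Set.finite_empty, ?_⟩
    rw [Set.ncard_empty, Nat.cast_zero]
    positivity
  set T := Fintype.piFinset fun i => Finset.Icc (-⌊n * (R * X ^ (1 / (n : ℝ))) ^ height (a i)⌋)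
      ⌊n * (R * X ^ (1 / (n : ℝ))) ^ height (a i)⌋ with hT
  choose! x k hxk hxJ hxn i₀ α hα hαK using hR X
  have hkT : ∀ K ∈ fieldsWithGroup G X, k K ∈ T := by
    intro K hK
    refine Fintype.mem_piFinset.mpr fun i => ?_
    have h1 := norm_aeval_traceFunction_le G g (a i) (x K) (hxn K hK)
    rw [hxk K hK, Complex.norm_intCast] at h1
    rw [Finset.mem_Icc, ← abs_le, Int.le_floor, Int.cast_abs]
    exact h1
  have hmain := Set.finite_and_ncard_le_of_forall_finset (s := fieldsWithGroup G X)
    (N := D * n * T.card) fun t ht => by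
      refine Finset.card_le_mul_card_image_of_maps_to (f := k) (fun K hK => hkT K (ht hK)) _
        fun c _ => ?_
      -- the fields with given values of the trace functions are determined by a nondegenerate
      -- point of the fibre and a letter
      set u := t.filter fun K => k K = c with hu
      have hut : ∀ K ∈ u, K ∈ fieldsWithGroup G X := fun K hK => ht (Finset.mem_filter.mp hK).1
      have h1 : (u.image x).card ≤ D := by
        refine hD (fun i => c i) _ fun y hy => ?_
        obtain ⟨K, hK, rfl⟩ := Finset.mem_image.mp hy
        refine ⟨fun i => ?_, hxJ K (hut K hK)⟩
        rw [eval_map_intCast, hxk K (hut K hK), (Finset.mem_filter.mp hK).2]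
      calc u.card = (u.image fun K => (x K, i₀ K)).card := by
            refine (Finset.card_image_of_injOn fun K hK K' hK' h => ?_).symm
            obtain ⟨h2, h3⟩ := Prod.mk.inj h
            have h4 : ι (α K) = ι (α K') := by
              rw [hα K (hut K hK), hα K' (hut K' hK'), h2, h3]
            rw [← hαK K (hut K hK), ← hαK K' (hut K' hK'), ι.toRingHom.injective h4]
        _ ≤ (u.image x ×ˢ (Finset.univ : Finset (Fin n))).card := by
            refine Finset.card_le_card fun z hz => ?_
            obtain ⟨K, hK, rfl⟩ := Finset.mem_image.mp hz
            exact Finset.mk_mem_product (Finset.mem_image_of_mem _ hK) (Finset.mem_univ _)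
        _ = (u.image x).card * n := by rw [Finset.card_product, Finset.card_univ, Fintype.card_fin]
        _ ≤ D * n := Nat.mul_le_mul_right _ h1
  refine ⟨hmain.1, ?_⟩
  calc (countFields G X : ℝ) ≤ (D * n * T.card : ℕ) := Nat.cast_le.mpr hmain.2
    _ = (D * n : ℕ) * (T.card : ℝ) := by rw [Nat.cast_mul]
    _ ≤ _ := by
        rw [mul_assoc]
        exact mul_le_mul_of_nonneg_left (card_integer_box_le R X hR0 hX1 _) (Nat.cast_nonneg _)

theorem mainTheorem1 (n r : ℕ) [NeZero n] (a : Fin n → Fin r → ℕ) :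
    ∃ C : ℝ, ∀ (G : Subgroup (Equiv.Perm (Fin n))) [MulAction.IsPretransitive G (Fin n)]
      (g : Fin r → NumberFieldCount.stabilizerNormalizer G),
      Function.Bijective
        (fun j => (QuotientGroup.mk (g j) : NumberFieldCount.normalizerQuotient G)) →
      (NumberFieldCount.jacobianMatrix
        (fun i => NumberFieldCount.traceFunction G g (a i))).det ≠ 0 →
      ∀ X : ℝ, 0 < X →
        (NumberFieldCount.fieldsWithGroup G X).Finite ∧
        (NumberFieldCount.countFields G X : ℝ) ≤
          C * X ^ ((1 / (n : ℝ)) * ∑ i : Fin n, (NumberFieldCount.height (a i) : ℝ)) := by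
  classical
  -- there are only finitely many pairs `(G, g)`, so a constant may be chosen for each of them
  have h : ∀ p : (G : Subgroup (Equiv.Perm (Fin n))) × (Fin r → stabilizerNormalizer G),
      ∃ C : ℝ, ∀ [MulAction.IsPretransitive p.1 (Fin n)],
        (jacobianMatrix (fun i => traceFunction p.1 p.2 (a i))).det ≠ 0 →
        ∀ X : ℝ, 0 < X → (fieldsWithGroup p.1 X).Finite ∧ (countFields p.1 X : ℝ) ≤
          C * X ^ ((1 / (n : ℝ)) * ∑ i : Fin n, (height (a i) : ℝ)) := by
    rintro ⟨G, g⟩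
    by_cases hG : MulAction.IsPretransitive G (Fin n)
    · by_cases hJ : (jacobianMatrix (fun i => traceFunction G g (a i))).det ≠ 0
      · obtain ⟨C, hC⟩ := exists_countFields_le a G g hJ
        exact ⟨C, fun _ => hC⟩
      · exact ⟨0, fun h => absurd h hJ⟩
    · exact ⟨0, fun {_} => absurd ‹_› hG⟩
  choose c hc using h
  obtain ⟨C, hC⟩ := Finite.exists_le c
  refine ⟨C, fun G _ g _ hJ X hX => ?_⟩
  obtain ⟨h1, h2⟩ := hc ⟨G, g⟩ hJ X hX
  exact ⟨h1, h2.trans (mul_le_mul_of_nonneg_right (hC ⟨G, g⟩) (by positivity))⟩
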